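/- Let $I$ be a set. A chamber system over $I$ is a set $\mathcal C$ (of chambers) with an equivalence relation $\sim_i$ on $\mathcal C$ for each $i\in I$. For $J\subseteq I$, a $J$-gallery is a finite sequence of chambers $(c_0,\dots,c_k)$, $k\ge 0$, such that for each $\mu\in\{1,\dots,k\}$ there is $j\in J$ with $c_{\mu-1}\sim_j c_\mu$; a gallery is an $I$-gallery. The $J$-residue $R_J(c)$ of a chamber $c$ is the set of chambers joined to $c$ by a $J$-gallery. A set $X$ of chambers is $J$-connected if any two chambers of $X$ are joined by a $J$-gallery contained in $X$, and connected if it is $I$-connected. A chamber map is a map $f$ between chamber systems over $I$ such that $c\sim_i d$ implies $f(c)\sim_i f(d)$; an automorphism is a bijective chamber map from a chamber system to itself whose inverse is a chamber map. Two galleries are elementary homotopic if one is obtained from the other by replacing a subsequence of consecutive chambers forming a $J$-gallery, for some $J\subseteq I$ with $|J|\le 2$, by a $J$-gallery with the same first and last chambers; homotopic means joined by a finite sequence of elementary homotopies. A chamber system is simply connected if it is connected and every gallery whose first and last chambers are equal, say to $c$, is homotopic to $(c)$. A twin chamber system $\mathcal C$ over $I$ consists of two chamber systems $\mathcal C_+,\mathcal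 C_-$ over $I$ and a symmetric relation $\mathrm{op}\subseteq(\mathcal C_+\times\mathcal C_-)\cup(\mathcal C_-\times\mathcal C_+)$ such that for each $\epsilon\in\{+,-\}$, writing $c^{\mathrm{op}}:=\{x\in\mathcal C_{-\epsilon} : c\ \mathrm{op}\ x\}$ for $c\in\mathcal C_\epsilon$: (TCS1) if $c,d\in\mathcal C_\epsilon$ with $c\sim_i d$ and $x,y\in\mathcal C_{-\epsilon}$ with $x\sim_j y$ satisfy $d\ \mathrm{op}\ x\ \mathrm{op}\ c\ \mathrm{op}\ y$, then $d\ \mathrm{op}\ y$ or $j=i$; (TCS2) if $c,d\in\mathcal C_\epsilon$ with $c\sim_i d$ and $x\in\mathcal C_{-\epsilon}$ with $x\ \mathrm{op}\ c$, then there is $y\in\mathcal C_{-\epsilon}$ with $x\sim_i y$ and $c\ \mathrm{op}\ y\ \mathrm{op}\ d$; (TCS3) for each $c\in\mathcal C_\epsilon$, the set $c^{\mathrm{op}}$ is connected, and for each $J\subseteq I$ with $|J|\le 2$ and each $J$-residue $R_J\subseteq\mathcal C_{-\epsilon}$, the set $c^{\mathrm{op}}\cap R_J$ is $J$-connected; (TCS4)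 for each $c\in\mathcal C_\epsilon$ there is a chamber map $\omega_c:\mathcal C_{-\epsilon}\to\mathcal C_\epsilon$ such that $\omega_c(x)\ \mathrm{op}\ x$ for all $x\in\mathcal C_{-\epsilon}$ and $\omega_c(c^{\mathrm{op}})=\{c\}$. Put $\mathrm{Opp}(\mathcal C):=\{(x,y)\in\mathcal C_+\times\mathcal C_- : x\ \mathrm{op}\ y\}$, and let $\mathrm{Aut}(\mathcal C)$ be the group of pairs consisting of an automorphism of $\mathcal C_+$ and an automorphism of $\mathcal C_-$ that preserve $\mathrm{op}$. The twin chamber system $\mathcal C$ is called simply connected if both $\mathcal C_+$ and $\mathcal C_-$ are simply connected. Let $\mathcal C$ be a simply connected twin chamber system over $I$, let $(c_+,c_-)\in\mathrm{Opp}(\mathcal C)$, and let $G$ be a group with a homomorphism $G\to\mathrm{Aut}(\mathcal C)$ whose image acts transitively on $\mathrm{Opp}(\mathcal C)$. For each $J\subseteq I$ with $|J|\le 2$, let $G_J$ be the subgroup of all $g\in G$ stabilising both $R_J(c_+)$ and $R_J(c_-)$. Then $G$ is the amalgamated product of the subgroups $G_J$, $J\subseteq I$, $|J|\le2$; that is,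 the canonical homomorphism to $G$ from the colimit of the system of groups $G_J$ and inclusions $G_J\hookrightarrow G_K$ ($J\subseteq K$, $|K|\le 2$) is an isomorphism. -/

import Mathlib

namespace TwinCS

/-- A chamber system over `I` with set of chambers `C`: an equivalence relation `∼ᵢ` on `C`
for each `i : I`. -/
structure ChamberSystem (I : Type*) (C : Type*) where
  /-- `i`-adjacency, an equivalence relation. -/
  adj : I → Setoid C

namespace ChamberSystem

variable {I C C' : Type*}

/-- `c ∼ⱼ d` for some index `j ∈ J`. -/
def AdjIn (S : ChamberSystem I C) (J : Set I) (c d : C) : Prop :=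
  ∃ j ∈ J, (S.adj j).r c d

/-- A `J`-gallery: a nonempty finite sequence of chambers `(c₀, …, c_k)` in which any two
consecutive chambers are `j`-adjacent for some `j ∈ J`. -/
def IsGalleryIn (S : ChamberSystem I C) (J : Set I) (G : List C) : Prop :=
  G ≠ [] ∧ G.IsChain (S.AdjIn J)

/-- A gallery: consecutive chambers are `i`-adjacent for some `i : I`. -/
def IsGallery (S : ChamberSystem I C) (G : List C) : Prop :=
  S.IsGalleryIn Set.univ G

/-- `G` is a `J`-gallery from `c` to `d`. -/
def JoinsIn (S : ChamberSystem I C) (J : Set I) (G : List C) (c d : C) : Prop :=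
  S.IsGalleryIn J G ∧ G.head? = some c ∧ G.getLast? = some d

/-- The `J`-residue of `c`: all chambers that can be joined to `c` by a `J`-gallery. -/
def residue (S : ChamberSystem I C) (J : Set I) (c : C) : Set C :=
  {d | ∃ G, S.JoinsIn J G c d}

/-- A set `X` of chambers is `J`-connected if any two of its chambers are joined by a
`J`-gallery all of whose chambers lie in `X`. -/
def ConnectedIn (S : ChamberSystem I C) (J : Set I) (X : Set C) : Prop :=
  ∀ c ∈ X, ∀ d ∈ X, ∃ G, S.JoinsIn J G c d ∧ ∀ x ∈ G, x ∈ X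

/-- The chamber system is connected: any two chambers are joined by a gallery. -/
def Connected (S : ChamberSystem I C) : Prop :=
  ∀ c d : C, ∃ G, S.JoinsIn Set.univ G c d

/-- Two galleries are elementary homotopic if they are of the form `p X q` and `p Y q`, where
`X`, `Y` are `J`-galleries with the same first and the same last chamber,
for some `J ⊆ I` with `|J| ≤ 2`. -/
def ElemHomotopic (S : ChamberSystem I C) (G H : List C) : Prop :=
  S.IsGallery G ∧ S.IsGallery H ∧
    ∃ (J : Set I) (p q X Y : List C), J.encard ≤ 2 ∧
      S.IsGalleryIn J X ∧ S.IsGalleryIn J Y ∧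
      X.head? = Y.head? ∧ X.getLast? = Y.getLast? ∧
      G = p ++ X ++ q ∧ H = p ++ Y ++ q

/-- Homotopy of galleries: a finite sequence of elementary homotopies. -/
def Homotopic (S : ChamberSystem I C) (G H : List C) : Prop :=
  Relation.ReflTransGen S.ElemHomotopic G H

/-- The chamber system is simply connected (in the sense of 2-homotopy): it is connected and each
closed gallery is homotopic to the gallery of length `0` at its first chamber. -/
def SimplyConnected (S : ChamberSystem I C) : Prop :=
  S.Connected ∧ ∀ (G : List C) (c : C), S.JoinsIn Set.univ G c c → S.Homotopic G [c]

/-- Chamber maps preserve `i`-adjacency for each `i`. -/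
def IsChamberMap (S : ChamberSystem I C) (S' : ChamberSystem I C') (f : C → C') : Prop :=
  ∀ (i : I) (c d : C), (S.adj i).r c d → (S'.adj i).r (f c) (f d)

/-- Automorphisms: bijective chamber maps whose inverse is also a chamber map. -/
def IsAut (S : ChamberSystem I C) (f : Equiv.Perm C) : Prop :=
  S.IsChamberMap S f ∧ S.IsChamberMap S f.symm

theorem IsGalleryIn.map {S : ChamberSystem I C} {S' : ChamberSystem I C'} {f : C → C'}
    (hf : S.IsChamberMap S' f) {J K : Set I} (hJK : J ⊆ K) {G : List C}
    (hG : S.IsGalleryIn J G) : S'.IsGalleryIn K (G.map f) := by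
  refine ⟨by simpa using hG.1, ?_⟩
  rw [List.isChain_map]
  exact hG.2.imp fun a b ⟨j, hj, h⟩ => ⟨j, hJK hj, hf j a b h⟩

theorem JoinsIn.map {S : ChamberSystem I C} {S' : ChamberSystem I C'} {f : C → C'}
    (hf : S.IsChamberMap S' f) {J K : Set I} (hJK : J ⊆ K) {G : List C} {c d : C}
    (hG : S.JoinsIn J G c d) : S'.JoinsIn K (G.map f) (f c) (f d) :=
  ⟨hG.1.map hf hJK, by simp [hG.2.1], by simp [hG.2.2]⟩

theorem mem_residue_self (S : ChamberSystem I C) (J : Set I) (c : C) : c ∈ S.residue J c :=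
  ⟨[c], ⟨by simp, by simp⟩, by simp, by simp⟩

theorem mem_residue_iff (S : ChamberSystem I C) (J : Set I) (c d : C) :
    d ∈ S.residue J c ↔ Relation.ReflTransGen (S.AdjIn J) c d := by
  constructor
  · rintro ⟨G, ⟨-, hG⟩, hc, hd⟩
    induction G generalizing c with
    | nil => simp at hc
    | cons a l ih =>
      obtain rfl : a = c := by simpa using hc
      cases l with
      | nil =>
        obtain rfl : a = d := by simpa using hd
        exact .refl
      | cons b l =>
        rw [List.isChain_cons_cons] at hG
        exact .head hG.1 (ih b hG.2 rfl (by simpa using hd))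
  · intro h
    induction h using Relation.ReflTransGen.head_induction_on with
    | refl => exact mem_residue_self S J d
    | @head a b hab _ ih =>
      obtain ⟨G, ⟨hne, hG⟩, hb, hd⟩ := ih
      cases G with
      | nil => exact absurd rfl hne
      | cons x l =>
        obtain rfl : x = b := by simpa using hb
        exact ⟨a :: x :: l, ⟨by simp, List.isChain_cons_cons.2 ⟨hab, hG⟩⟩, by simp,
          by simpa using hd⟩

theorem residue_eq_of_mem (S : ChamberSystem I C) {J : Set I} {c d : C}
    (h : d ∈ S.residue J c) : S.residue J d = S.residue J c := by
  have hs : ∀ a b, S.AdjIn J a b → S.AdjIn J b a :=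
    fun a b ⟨j, hj, h⟩ => ⟨j, hj, (S.adj j).symm h⟩
  rw [mem_residue_iff] at h
  have h' : Relation.ReflTransGen (S.AdjIn J) d c := by
    induction h with
    | refl => exact .refl
    | tail _ hbc ih => exact .head (hs _ _ hbc) ih
  ext x
  rw [mem_residue_iff, mem_residue_iff]
  exact ⟨fun hx => h.trans hx, fun hx => h'.trans hx⟩

theorem IsAut.image_residue {S : ChamberSystem I C} {f : Equiv.Perm C} (hf : S.IsAut f)
    (J : Set I) (c : C) : f '' S.residue J c = S.residue J (f c) := by
  ext d
  constructor
  · rintro ⟨x, ⟨G, hG⟩, rfl⟩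
    exact ⟨_, hG.map hf.1 subset_rfl⟩
  · rintro ⟨G, hG⟩
    refine ⟨f.symm d, ⟨G.map f.symm, ?_⟩, by simp⟩
    simpa using hG.map hf.2 subset_rfl

theorem residue_mono (S : ChamberSystem I C) {J K : Set I} (hJK : J ⊆ K) (c : C) :
    S.residue J c ⊆ S.residue K c := by
  rintro d ⟨G, hG⟩
  refine ⟨G, ?_⟩
  have := hG.map (f := id) (S' := S) (fun _ _ _ h => h) hJK
  simpa using this

/-- An automorphism stabilising the `J`-residue of `c` stabilises its `K`-residue
for `J ⊆ K`. -/
theorem IsAut.image_residue_eq_of_subset {S : ChamberSystem I C} {f : Equiv.Perm C}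
    (hf : S.IsAut f) {J K : Set I} (hJK : J ⊆ K) {c : C}
    (h : f '' S.residue J c = S.residue J c) : f '' S.residue K c = S.residue K c := by
  rw [hf.image_residue]
  refine S.residue_eq_of_mem (S.residue_mono hJK c ?_)
  rw [← h]
  exact ⟨c, S.mem_residue_self J c, rfl⟩

end ChamberSystem

/-- An opposition datum over `I`: two chamber systems over `I` together with an opposition
relation between their chambers. (The symmetric relation is given by its part in `Cp × Cm`.) -/
structure OppositionDatum (I : Type*) (Cp : Type*) (Cm : Type*) where
  /-- The positive half. -/
  plus : ChamberSystem I Cp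
  /-- The negative half. -/
  minus : ChamberSystem I Cm
  /-- Opposition. -/
  op : Cp → Cm → Prop

namespace OppositionDatum

variable {I Cp Cm G : Type*}

/-- The same datum with the roles of the two signs exchanged. -/
def swap (D : OppositionDatum I Cp Cm) : OppositionDatum I Cm Cp where
  plus := D.minus
  minus := D.plus
  op := fun x c => D.op c x

/-- The set `c^op` of chambers opposite to `c`, for `c` in the positive half. -/
def opSet (D : OppositionDatum I Cp Cm) (c : Cp) : Set Cm :=
  {x | D.op c x}

/-- First axiom for twin chamber systems, with `c`, `d` in the positive half. -/
def TCS1 (D : OppositionDatum I Cp Cm) : Prop :=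
  ∀ (i j : I) (c d : Cp) (x y : Cm), (D.plus.adj i).r c d → (D.minus.adj j).r x y →
    D.op d x → D.op c x → D.op c y → D.op d y ∨ j = i

/-- Second axiom for twin chamber systems, with `c`, `d` in the positive half. -/
def TCS2 (D : OppositionDatum I Cp Cm) : Prop :=
  ∀ (i : I) (c d : Cp) (x : Cm), (D.plus.adj i).r c d → D.op c x →
    ∃ y : Cm, (D.minus.adj i).r x y ∧ D.op c y ∧ D.op d y

/-- Third axiom for twin chamber systems, with `c` in the positive half: `c^op` is connected, and
for each `J`-residue `R` with `|J| ≤ 2` the set `c^op ∩ R` is connected by `J`-galleries. -/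
def TCS3 (D : OppositionDatum I Cp Cm) : Prop :=
  ∀ c : Cp, D.minus.ConnectedIn Set.univ (D.opSet c) ∧
    ∀ (J : Set I) (z : Cm), J.encard ≤ 2 →
      D.minus.ConnectedIn J (D.opSet c ∩ D.minus.residue J z)

/-- Fourth axiom for twin chamber systems, with `c` in the positive half. -/
def TCS4 (D : OppositionDatum I Cp Cm) : Prop :=
  ∀ c : Cp, ∃ ω : Cm → Cp, D.minus.IsChamberMap D.plus ω ∧
    (∀ x : Cm, D.op (ω x) x) ∧ ω '' D.opSet c = {c}

/-- Twin chamber systems: the four axioms hold for both signs. -/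
structure IsTwin (D : OppositionDatum I Cp Cm) : Prop where
  tcs1 : D.TCS1 ∧ D.swap.TCS1
  tcs2 : D.TCS2 ∧ D.swap.TCS2
  tcs3 : D.TCS3 ∧ D.swap.TCS3
  tcs4 : D.TCS4 ∧ D.swap.TCS4

/-- Both halves are simply connected. -/
def SimplyConnected (D : OppositionDatum I Cp Cm) : Prop :=
  D.plus.SimplyConnected ∧ D.minus.SimplyConnected

/-- The set of opposite pairs. -/
def Opp (D : OppositionDatum I Cp Cm) : Set (Cp × Cm) :=
  {p | D.op p.1 p.2}

/-- The automorphism group: pairs of automorphisms of the two halves preserving opposition. -/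
def Aut (D : OppositionDatum I Cp Cm) : Subgroup (Equiv.Perm Cp × Equiv.Perm Cm) where
  carrier := {f | D.plus.IsAut f.1 ∧ D.minus.IsAut f.2 ∧
    ∀ x y, D.op (f.1 x) (f.2 y) ↔ D.op x y}
  one_mem' := ⟨⟨fun _ _ _ h => h, fun _ _ _ h => h⟩, ⟨fun _ _ _ h => h, fun _ _ _ h => h⟩,
    fun _ _ => Iff.rfl⟩
  mul_mem' := by
    rintro f g ⟨⟨a1, a2⟩, ⟨b1, b2⟩, c⟩ ⟨⟨a1', a2'⟩, ⟨b1', b2'⟩, c'⟩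
    exact ⟨⟨fun i x y h => a1 _ _ _ (a1' _ _ _ h), fun i x y h => a2' _ _ _ (a2 _ _ _ h)⟩,
      ⟨fun i x y h => b1 _ _ _ (b1' _ _ _ h), fun i x y h => b2' _ _ _ (b2 _ _ _ h)⟩,
      fun x y => (c _ _).trans (c' _ _)⟩
  inv_mem' := by
    rintro f ⟨⟨a1, a2⟩, ⟨b1, b2⟩, c⟩
    refine ⟨⟨a2, a1⟩, ⟨b2, b1⟩, fun x y => ?_⟩
    have := c (f⁻¹.1 x) (f⁻¹.2 y)
    simpa using this.symm

/-- `G` acts on `D` through `φ`, and the action on the set of opposite pairs is transitive. -/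
def ActsTransitively [Group G] (D : OppositionDatum I Cp Cm) (φ : G →* D.Aut) : Prop :=
  ∀ p ∈ D.Opp, ∀ q ∈ D.Opp, ∃ g : G, (φ g).1.1 p.1 = q.1 ∧ (φ g).1.2 p.2 = q.2

/-- The subgroup of all `g : G` stabilising the `J`-residues of `c` and of `d`. -/
def stab [Group G] (D : OppositionDatum I Cp Cm) (φ : G →* D.Aut) (c : Cp) (d : Cm)
    (J : Set I) : Subgroup G where
  carrier := {g | (φ g).1.1 '' D.plus.residue J c = D.plus.residue J c ∧
    (φ g).1.2 '' D.minus.residue J d = D.minus.residue J d}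
  one_mem' := by simp
  mul_mem' := by
    rintro g h ⟨g1, g2⟩ ⟨h1, h2⟩
    simp only [Set.mem_ofPred_eq, map_mul, Subgroup.coe_mul, Prod.fst_mul, Prod.snd_mul,
      Equiv.Perm.coe_mul, Set.image_comp]
    rw [h1, h2]
    exact ⟨g1, g2⟩
  inv_mem' := by
    rintro g ⟨g1, g2⟩
    simp only [Set.mem_ofPred_eq, map_inv, Subgroup.coe_inv, Prod.fst_inv, Prod.snd_inv]
    constructor
    · conv_lhs => rw [← g1]
      rw [← Set.image_comp, ← Equiv.Perm.coe_mul, inv_mul_cancel]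
      simp
    · conv_lhs => rw [← g2]
      rw [← Set.image_comp, ← Equiv.Perm.coe_mul, inv_mul_cancel]
      simp

theorem stab_mono [Group G] (D : OppositionDatum I Cp Cm) (φ : G →* D.Aut) (c : Cp) (d : Cm) :
    Monotone (D.stab φ c d) := fun _ _ hJK g hg =>
  ⟨(φ g).2.1.image_residue_eq_of_subset hJK hg.1,
    (φ g).2.2.1.image_residue_eq_of_subset hJK hg.2⟩

end OppositionDatum

section Amalgam

variable {G ι : Type*} [Group G] [Preorder ι]

/-- The relators that identify, for `i ≤ j`, each element of `H i` with its image
under the inclusion of `H i` into `H j`. -/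
def amalgamRel (H : ι → Subgroup G) (hH : Monotone H) : Set (Monoid.CoprodI fun i => ↥(H i)) :=
  {r | ∃ (i j : ι) (hij : i ≤ j) (x : H i),
    r = Monoid.CoprodI.of (M := fun i => ↥(H i)) (i := i) x *
      (Monoid.CoprodI.of (M := fun i => ↥(H i)) (i := j) (Subgroup.inclusion (hH hij) x))⁻¹}

/-- The amalgamated product (colimit) of a system of subgroups of `G` and inclusions between
them: the free product of the subgroups modulo the identifications given by the inclusions. -/
abbrev Amalgam (H : ι → Subgroup G) (hH : Monotone H) : Type _ :=
  (Monoid.CoprodI fun i => ↥(H i)) ⧸ Subgroup.normalClosure (amalgamRel H hH)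

/-- The canonical homomorphism from the amalgamated product to `G`, which restricts to the
inclusion of each of the subgroups. -/
def Amalgam.toGroup (H : ι → Subgroup G) (hH : Monotone H) : Amalgam H hH →* G :=
  QuotientGroup.lift _ (Monoid.CoprodI.lift fun i => (H i).subtype) <|
    Subgroup.normalClosure_le_normal (by
      rintro _ ⟨i, j, hij, x, rfl⟩
      simp [MonoidHom.mem_ker])

/-- `G` is the amalgamated product of the subgroups `H i`. -/
def IsAmalgamatedProduct (H : ι → Subgroup G) (hH : Monotone H) : Prop :=
  Function.Bijective (Amalgam.toGroup H hH)

end Amalgam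

end TwinCS

/-! Choose for every opposite pair `p` an element `s p` of `G` carrying the base pair to `p`. For
adjacent opposite pairs `p`, `q` the element `(s p)⁻¹ * s q` lies in some `G_{i}`; its image in the
amalgam labels the step. On residues of rank at most two these labels have a potential, namely `(s
p₀)⁻¹ * s p` read in `G_J`. If they have a global potential `Φ` on all opposite pairs, then `Φ`,
corrected by the stabiliser of the base pair, gives a map from `G` to the amalgam that is compatible
with right multiplication by each `G_J`, and the canonical map is injective. Surjectivity only needs
opposite pairs to be connected.

The core is `IsTwin.exists_potential`: local exactness implies global exactness on opposite pairs,
an algebraic form of their simple connectedness. (TCS4) pulls the labels back to the simply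
connected negative half and yields a potential on each fibre `c^op`. For adjacent `c`, `d` the two
fibre potentials differ by a constant, by (TCS2) and (TCS3). These constants form a locally exact
labelling of the positive half, whose potential glues the fibre potentials together. -/

namespace TwinCS

/-! ### Labellings, holonomy and potentials on a chamber system. -/

namespace ChamberSystem

variable {I C A : Type*}

theorem ConnectedIn.eq_of_step {S : ChamberSystem I C} {J : Set I} {X : Set C}
    (h : S.ConnectedIn J X) {β : Type*} (F : C → β)
    (hF : ∀ j ∈ J, ∀ x ∈ X, ∀ y ∈ X, (S.adj j).r x y → F x = F y)
    {c d : C} (hc : c ∈ X) (hd : d ∈ X) : F c = F d := by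
  obtain ⟨G, ⟨⟨-, hG⟩, h1, h2⟩, hX⟩ := h c hc d hd
  clear hc
  induction G generalizing c with
  | nil => simp at h1
  | cons a l ih =>
    obtain rfl : a = c := by simpa using h1
    cases l with
    | nil =>
      obtain rfl : a = d := by simpa using h2
      rfl
    | cons b l =>
      rw [List.isChain_cons_cons] at hG
      obtain ⟨⟨j, hj, hab⟩, hG⟩ := hG
      exact (hF j hj a (hX a (by simp)) b (hX b (by simp)) hab).trans
        (ih (c := b) (fun x hx => hX x (List.mem_cons_of_mem a hx)) hG rfl (by simpa using h2))

theorem encard_pair_le_two {α : Type*} (a b : α) : ({a, b} : Set α).encard ≤ 2 :=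
  (Set.encard_insert_le _ _).trans (by rw [Set.encard_singleton]; norm_num)

theorem adj_mem_residue (S : ChamberSystem I C) {J : Set I} {j : I} (hj : j ∈ J) {c d e : C}
    (hd : d ∈ S.residue J c) (h : (S.adj j).r d e) : e ∈ S.residue J c := by
  rw [mem_residue_iff] at hd ⊢
  exact hd.tail ⟨j, hj, h⟩

theorem IsChamberMap.mem_residue {C' : Type*} {S : ChamberSystem I C} {S' : ChamberSystem I C'}
    {f : C → C'} (hf : S.IsChamberMap S' f) {J : Set I} {c d : C} (h : d ∈ S.residue J c) :
    f d ∈ S'.residue J (f c) := by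
  obtain ⟨G, hG⟩ := h
  exact ⟨_, hG.map hf subset_rfl⟩

variable [Group A]

/-- `f` is a potential for the labelling `l` of the `J`-adjacent pairs of chambers of `X`. -/
def IsPotentialOn (S : ChamberSystem I C) (J : Set I) (X : Set C) (l : I → C → C → A)
    (f : C → A) : Prop :=
  ∀ j ∈ J, ∀ x ∈ X, ∀ y ∈ X, (S.adj j).r x y → f y = f x * l j x y

/-- The labelling `l` has a potential on each residue of rank at most two. -/
def LocallyExact (S : ChamberSystem I C) (l : I → C → C → A) : Prop :=
  ∀ J : Set I, J.encard ≤ 2 → ∀ z, ∃ f, S.IsPotentialOn J (S.residue J z) l f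

/-- The product of the labels along a gallery. -/
def holonomy (m : C → C → A) : List C → A
  | [] => 1
  | [_] => 1
  | x :: y :: t => m x y * holonomy m (y :: t)

theorem holonomy_append (m : C → C → A) {G H : List C} {x y : C}
    (hG : G.getLast? = some x) (hH : H.head? = some y) :
    holonomy m (G ++ H) = holonomy m G * m x y * holonomy m H := by
  induction G with
  | nil => simp at hG
  | cons a l ih =>
    cases l with
    | nil =>
      obtain rfl : a = x := by simpa using hG
      cases H with
      | nil => simp at hH
      | cons b t =>
        obtain rfl : b = y := by simpa using hH
        simp [holonomy]
    | cons b l =>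
      have := ih (by simpa using hG)
      simp only [List.cons_append, holonomy] at this ⊢
      rw [this]
      simp only [mul_assoc]

/-- The labels at the two junctions depend only on the end chambers of the middle piece, so only its
own holonomy matters. -/
theorem holonomy_congr (m : C → C → A) {X Y : List C} (hX : X ≠ [])
    (hh : X.head? = Y.head?) (hl : X.getLast? = Y.getLast?)
    (h : holonomy m X = holonomy m Y) (p q : List C) :
    holonomy m (p ++ X ++ q) = holonomy m (p ++ Y ++ q) := by
  obtain ⟨x, hx⟩ : ∃ x, X.getLast? = some x := ⟨_, List.getLast?_eq_some_getLast hX⟩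
  obtain ⟨y, hy⟩ : ∃ y, X.head? = some y := ⟨_, List.head?_eq_some_head hX⟩
  have hXq : holonomy m (X ++ q) = holonomy m (Y ++ q) := by
    cases q with
    | nil => simpa using h
    | cons b t =>
      rw [holonomy_append m hx (y := b) rfl, holonomy_append m (hl ▸ hx) (y := b) rfl, h]
  rw [List.append_assoc, List.append_assoc]
  rcases p.eq_nil_or_concat' with rfl | ⟨t, b, rfl⟩
  · simpa using hXq
  · rw [holonomy_append m (G := t ++ [b]) (H := X ++ q) (x := b) (y := y) (by simp)
        (by simp [List.head?_append, hy]), hXq,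
      holonomy_append m (G := t ++ [b]) (H := Y ++ q) (x := b) (y := y) (by simp)
        (by simp [List.head?_append, ← hh, hy])]

theorem IsPotentialOn.holonomy_eq {S : ChamberSystem I C} {J : Set I} {z : C}
    {l : I → C → C → A} {f : C → A} (hf : S.IsPotentialOn J (S.residue J z) l f)
    {m : C → C → A} (hm : ∀ i x y, (S.adj i).r x y → m x y = l i x y)
    {G : List C} {c d : C} (hG : S.JoinsIn J G c d) (hc : c ∈ S.residue J z) :
    f d = f c * holonomy m G := by
  obtain ⟨⟨-, hG⟩, h1, h2⟩ := hG
  induction G generalizing c with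
  | nil => simp at h1
  | cons a t ih =>
    obtain rfl : a = c := by simpa using h1
    cases t with
    | nil =>
      obtain rfl : a = d := by simpa using h2
      simp [holonomy]
    | cons b t =>
      rw [List.isChain_cons_cons] at hG
      obtain ⟨⟨j, hj, hab⟩, hG⟩ := hG
      have hb := S.adj_mem_residue hj hc hab
      rw [ih hb hG rfl (by simpa using h2), hf j hj a hc b hb hab, holonomy, hm j a b hab, mul_assoc]

/-- An elementary homotopy takes place inside one residue of rank at most two, where a potential
determines the holonomy from the end chambers. -/
theorem Homotopic.holonomy_eq {S : ChamberSystem I C} {l : I → C → C → A} (hl : S.LocallyExact l)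
    {m : C → C → A} (hm : ∀ i x y, (S.adj i).r x y → m x y = l i x y) {G H : List C}
    (h : S.Homotopic G H) : holonomy m G = holonomy m H := by
  induction h with
  | refl => rfl
  | tail _ h ih =>
    rw [ih]
    obtain ⟨-, -, J, p, q, X, Y, hJ, hX, hY, hh, hla, rfl, rfl⟩ := h
    refine holonomy_congr m hX.1 hh hla ?_ p q
    have hx : X.getLast? = some _ := List.getLast?_eq_some_getLast hX.1
    have hy : X.head? = some _ := List.head?_eq_some_head hX.1
    obtain ⟨f, hf⟩ := hl J hJ (X.head hX.1)
    have h1 := hf.holonomy_eq hm ⟨hX, hy, hx⟩ (S.mem_residue_self J _)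
    have h2 := hf.holonomy_eq hm ⟨hY, hh ▸ hy, hla ▸ hx⟩ (S.mem_residue_self J _)
    exact mul_left_cancel (h1.symm.trans h2)

/-- Allows labels to be attached to pairs of chambers, as galleries do not record the types of their
steps. The potential on the `{i, j}`-residue sees both labels. -/
theorem LocallyExact.eq_of_adj {S : ChamberSystem I C} {l : I → C → C → A}
    (hl : S.LocallyExact l) {i j : I} {x y : C} (hi : (S.adj i).r x y) (hj : (S.adj j).r x y) :
    l i x y = l j x y := by
  obtain ⟨f, hf⟩ := hl {i, j} (encard_pair_le_two i j) x
  have hx := S.mem_residue_self {i, j} x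
  have hy := S.adj_mem_residue (J := {i, j}) (by simp) hx hi
  exact mul_left_cancel ((hf i (by simp) x hx y hy hi).symm.trans (hf j (by simp) x hx y hy hj))

/-- On a simply connected chamber system, locally exact labellings are exact. -/
theorem SimplyConnected.exists_isPotentialOn {S : ChamberSystem I C} (hS : S.SimplyConnected)
    {l : I → C → C → A} (hl : S.LocallyExact l) :
    ∃ f, S.IsPotentialOn Set.univ Set.univ l f := by
  classical
  rcases isEmpty_or_nonempty C with _ | ⟨⟨o⟩⟩
  · exact ⟨fun _ => 1, fun _ _ x => isEmptyElim x⟩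
  -- The value `1` on non-adjacent pairs never enters, since consecutive chambers of a gallery are
  -- adjacent.
  let m : C → C → A := fun x y => if h : ∃ i, (S.adj i).r x y then l h.choose x y else 1
  have hm : ∀ i x y, (S.adj i).r x y → m x y = l i x y := by
    intro i x y h
    have h' : ∃ i, (S.adj i).r x y := ⟨i, h⟩
    simp only [m, dif_pos h']
    exact hl.eq_of_adj h'.choose_spec h
  choose γ hγ using hS.1 o
  choose δ hδ using fun x => hS.1 x o
  -- `γ x` followed by `δ y` is a closed gallery at `o`, hence null-homotopic.
  have key : ∀ i x y, (S.adj i).r x y → holonomy m (γ x) * m x y * holonomy m (δ y) = 1 := by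
    intro i x y h
    rw [← holonomy_append m (hγ x).2.2 (hδ y).2.1]
    refine Homotopic.holonomy_eq hl hm (H := [o]) (hS.2 _ o ⟨⟨?_, ?_⟩, ?_, ?_⟩)
    · simp [(hγ x).1.1]
    · refine List.isChain_append.2 ⟨(hγ x).1.2, (hδ y).1.2, ?_⟩
      intro a ha b hb
      rw [(hγ x).2.2] at ha
      rw [(hδ y).2.1] at hb
      obtain rfl : x = a := by simpa using ha
      obtain rfl : y = b := by simpa using hb
      exact ⟨i, trivial, h⟩
    · simp [List.head?_append, (hγ x).2.1]
    · simp [List.getLast?_append, (hδ y).2.2]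
  refine ⟨fun x => holonomy m (γ x), fun i _ x _ y _ h => ?_⟩
  have h1 : l i y y = 1 := by
    obtain ⟨f, hf⟩ := hl {i} (by simp) y
    simpa using hf i rfl y (S.mem_residue_self _ y) y (S.mem_residue_self _ y) ((S.adj i).refl y)
  -- Adjacency is reflexive, so `key` also applies to `(y, y)`; comparing it with `(x, y)` cancels
  -- the return path `δ y`.
  have h2 := key i y y ((S.adj i).refl y)
  rw [hm i y y ((S.adj i).refl y), h1, mul_one] at h2
  have h3 := key i x y h
  rw [hm i x y h] at h3
  exact mul_right_cancel (h2.trans h3.symm)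

end ChamberSystem

/-! ### Potentials on the opposite pairs of a twin chamber system. -/

namespace OppositionDatum

open ChamberSystem

variable {I Cp Cm A : Type*} {D : OppositionDatum I Cp Cm}

/-- Axiom (TCS2) along galleries. -/
theorem IsTwin.exists_op_of_mem_residue (hD : D.IsTwin) {J : Set I} {c d : Cp} {x : Cm}
    (hcx : D.op c x) (hd : d ∈ D.plus.residue J c) :
    ∃ y ∈ D.minus.residue J x, D.op d y := by
  rw [mem_residue_iff] at hd
  induction hd with
  | refl => exact ⟨x, D.minus.mem_residue_self J x, hcx⟩
  | tail _ h ih =>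
    obtain ⟨y, hy, hop⟩ := ih
    obtain ⟨j, hj, h⟩ := h
    obtain ⟨z, hyz, -, hz⟩ := hD.tcs2.1 j _ _ y h hop
    exact ⟨z, D.minus.adj_mem_residue hj hy hyz, hz⟩

/-- Connectedness of the opposite pairs in two residues, phrased for invariants: move within a fibre
by `hconn`, and change the fibre by (TCS2). It serves both for rank at most two and for `J =
Set.univ`. -/
theorem IsTwin.eq_of_step (hD : D.IsTwin) {J : Set I} {c : Cp} {x : Cm}
    (hconn : ∀ d, D.minus.ConnectedIn J (D.opSet d ∩ D.minus.residue J x))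
    {β : Type*} (F : Cp → Cm → β)
    (hF : ∀ j ∈ J, ∀ d ∈ D.plus.residue J c, ∀ d' ∈ D.plus.residue J c,
      ∀ y ∈ D.minus.residue J x, ∀ y' ∈ D.minus.residue J x, D.op d y → D.op d' y' →
      (D.plus.adj j).r d d' → (D.minus.adj j).r y y' → F d y = F d' y')
    (hcx : D.op c x) {d : Cp} {y : Cm} (hd : d ∈ D.plus.residue J c)
    (hy : y ∈ D.minus.residue J x) (hdy : D.op d y) : F c x = F d y := by
  have fib : ∀ d ∈ D.plus.residue J c, ∀ y ∈ D.minus.residue J x, ∀ y' ∈ D.minus.residue J x,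
      D.op d y → D.op d y' → F d y = F d y' := fun d hd y hy y' hy' h h' =>
    (hconn d).eq_of_step (F d) (fun j hj u hu v hv huv =>
      hF j hj d hd d hd u hu.2 v hv.2 hu.1 hv.1 ((D.plus.adj j).refl d) huv) ⟨h, hy⟩ ⟨h', hy'⟩
  suffices h : ∃ z ∈ D.minus.residue J x, D.op d z ∧ F c x = F d z by
    obtain ⟨z, hz, hop, h⟩ := h
    exact h.trans (fib d hd z hz y hy hop hdy)
  clear hdy
  rw [mem_residue_iff] at hd
  induction hd with
  | refl => exact ⟨x, D.minus.mem_residue_self J x, hcx, rfl⟩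
  | @tail d e hd h ih =>
    obtain ⟨z, hz, hop, ih⟩ := ih
    obtain ⟨j, hj, h⟩ := h
    rw [← mem_residue_iff] at hd
    obtain ⟨w, hzw, hdw, hew⟩ := hD.tcs2.1 j _ _ z h hop
    have hw := D.minus.adj_mem_residue hj hz hzw
    exact ⟨w, hw, hew, ih.trans (hF j hj d hd e (D.plus.adj_mem_residue hj hd h) z hz w hw hop hew
      h hzw)⟩

variable [Group A]

/-- `f` is a potential for `l` on the opposite pairs in the `J`-residues of `c` and `x`. -/
def IsPotentialAt (D : OppositionDatum I Cp Cm) (J : Set I) (c : Cp) (x : Cm)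
    (l : I → Cp × Cm → Cp × Cm → A) (f : Cp → Cm → A) : Prop :=
  ∀ j ∈ J, ∀ d ∈ D.plus.residue J c, ∀ d' ∈ D.plus.residue J c,
    ∀ y ∈ D.minus.residue J x, ∀ y' ∈ D.minus.residue J x, D.op d y → D.op d' y' →
    (D.plus.adj j).r d d' → (D.minus.adj j).r y y' → f d' y' = f d y * l j (d, y) (d', y')

/-- The labelling `l` has a potential on the opposite pairs in each two residues of the same type
of rank at most two. -/
def LocallyExact (D : OppositionDatum I Cp Cm) (l : I → Cp × Cm → Cp × Cm → A) : Prop :=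
  ∀ J : Set I, J.encard ≤ 2 → ∀ c x, ∃ f, D.IsPotentialAt J c x l f

/-- `f` is a potential for `l` on the pairs `(c, x)` with `x` opposite to `c`. -/
def IsFiberPotential (D : OppositionDatum I Cp Cm) (l : I → Cp × Cm → Cp × Cm → A) (c : Cp)
    (f : Cm → A) : Prop :=
  ∀ i x y, D.op c x → D.op c y → (D.minus.adj i).r x y → f y = f x * l i (c, x) (c, y)

variable {l : I → Cp × Cm → Cp × Cm → A}

/-- The section `x ↦ (ω x, x)` from (TCS4) extends the labels on `c^op` to the whole negative half,
where simple connectedness applies; on `c^op` itself `ω` is constantly `c`. -/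
theorem IsTwin.exists_isFiberPotential (hD : D.IsTwin) (hsc : D.SimplyConnected)
    (hl : D.LocallyExact l) (c : Cp) : ∃ f, D.IsFiberPotential l c f := by
  obtain ⟨ω, hω, hop, hc⟩ := hD.tcs4.1 c
  obtain ⟨f, hf⟩ := hsc.2.exists_isPotentialOn
    (l := fun i x y => l i (ω x, x) (ω y, y)) (fun J hJ z => by
      obtain ⟨f, hf⟩ := hl J hJ (ω z) z
      exact ⟨fun x => f (ω x) x, fun j hj x hx y hy hxy => hf j hj _ (hω.mem_residue hx) _
        (hω.mem_residue hy) x hx y hy (hop x) (hop y) (hω j x y hxy) hxy⟩)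
  have hωc : ∀ x, D.op c x → ω x = c := fun x hx => by
    have : ω x ∈ ω '' D.opSet c := ⟨x, hx, rfl⟩
    rw [hc] at this
    exact this
  refine ⟨f, fun i x y hx hy h => ?_⟩
  have := hf i trivial x trivial y trivial h
  simpa only [hωc x hx, hωc y hy] using this

/-- Two potentials of the same labels differ by a constant left factor on the `J`-connected set of
(TCS3). -/
theorem IsTwin.fiberPotential_eq (hD : D.IsTwin) {J : Set I} (hJ : J.encard ≤ 2) {c d : Cp}
    {x y y' : Cm} {f : Cp → Cm → A} (hf : D.IsPotentialAt J c x l f) {g : Cm → A}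
    (hg : D.IsFiberPotential l d g) (hd : d ∈ D.plus.residue J c)
    (hy : y ∈ D.minus.residue J x) (hy' : y' ∈ D.minus.residue J x) (h : D.op d y)
    (h' : D.op d y') : f d y * (g y)⁻¹ = f d y' * (g y')⁻¹ := by
  refine ((hD.tcs3.1 d).2 J x hJ).eq_of_step (fun y => f d y * (g y)⁻¹) ?_ ⟨h, hy⟩ ⟨h', hy'⟩
  rintro j hj u ⟨hu, hu'⟩ v ⟨hv, hv'⟩ huv
  rw [hg j u v hu hv huv,
    hf j hj d hd d hd u hu' v hv' hu hv ((D.plus.adj j).refl d) huv]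
  group

/-- The transition between the fibres over two `i`-adjacent chambers, computed at `y`. -/
def transition (l : I → Cp × Cm → Cp × Cm → A) (Φ : Cp → Cm → A) (i : I) (c d : Cp) (y : Cm) : A :=
  Φ c y * l i (c, y) (d, y) * (Φ d y)⁻¹

/-- A local potential `f` writes the transition as a quotient of the constants by which `f` differs
from `Φ c` and `Φ d`. -/
theorem IsTwin.transition_eq_of_mem_residue (hD : D.IsTwin) (hl : D.LocallyExact l)
    {Φ : Cp → Cm → A} (hΦ : ∀ c, D.IsFiberPotential l c (Φ c)) {J : Set I} (hJ : J.encard ≤ 2)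
    {i : I} (hi : i ∈ J) {c d : Cp} (hcd : (D.plus.adj i).r c d) {x y y' : Cm}
    (hy : y ∈ D.minus.residue J x) (hy' : y' ∈ D.minus.residue J x) (hcy : D.op c y)
    (hdy : D.op d y) (hcy' : D.op c y') (hdy' : D.op d y') :
    transition l Φ i c d y = transition l Φ i c d y' := by
  obtain ⟨f, hf⟩ := hl J hJ c x
  have hc := D.plus.mem_residue_self J c
  have hd := D.plus.adj_mem_residue hi hc hcd
  have e1 := hD.fiberPotential_eq hJ hf (hΦ c) hc hy hy' hcy hcy'
  have e2 := hD.fiberPotential_eq hJ hf (hΦ d) hd hy hy' hdy hdy'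
  have e3 := hf i hi c hc d hd y hy y hy hcy hdy hcd ((D.minus.adj i).refl y)
  have e4 := hf i hi c hc d hd y' hy' y' hy' hcy' hdy' hcd ((D.minus.adj i).refl y')
  have a : transition l Φ i c d y = (f c y * (Φ c y)⁻¹)⁻¹ * (f d y * (Φ d y)⁻¹) := by
    rw [e3, transition]; group
  have b : transition l Φ i c d y' = (f c y' * (Φ c y')⁻¹)⁻¹ * (f d y' * (Φ d y')⁻¹) := by
    rw [e4, transition]; group
  rw [a, b, e1, e2]

theorem IsTwin.transition_eq (hD : D.IsTwin) (hl : D.LocallyExact l)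
    {Φ : Cp → Cm → A} (hΦ : ∀ c, D.IsFiberPotential l c (Φ c))
    {i : I} {c d : Cp} (hcd : (D.plus.adj i).r c d) {y y' : Cm} (hcy : D.op c y)
    (hdy : D.op d y) (hcy' : D.op c y') (hdy' : D.op d y') :
    transition l Φ i c d y = transition l Φ i c d y' := by
  -- A gallery in `c^op` may leave `d^op`, so each `u` is replaced by an `i`-adjacent `z u` opposite
  -- to both. For `j`-adjacent `u`, `v`, the chambers `z u` and `z v` share an `{i, j}`-residue.
  choose! z hz using fun u => hD.tcs2.1 i c d u hcd
  have self : ∀ u, D.op c u → D.op d u →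
      transition l Φ i c d u = transition l Φ i c d (z u) := fun u hu hu' =>
    hD.transition_eq_of_mem_residue hl hΦ (J := {i}) (by simp) rfl hcd
      (D.minus.mem_residue_self _ u)
      (D.minus.adj_mem_residue (Set.mem_singleton i) (D.minus.mem_residue_self _ u) (hz u hu).1) hu hu'
      (hz u hu).2.1 (hz u hu).2.2
  rw [self y hcy hdy, self y' hcy' hdy']
  refine (hD.tcs3.1 c).1.eq_of_step (fun u => transition l Φ i c d (z u)) ?_ hcy hcy'
  intro j _ u hu v hv huv
  have hu' := D.minus.mem_residue_self {i, j} u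
  have hv' := D.minus.adj_mem_residue (J := {i, j}) (by simp) hu' huv
  exact hD.transition_eq_of_mem_residue hl hΦ (encard_pair_le_two i j) (by simp) hcd
    (D.minus.adj_mem_residue (by simp) hu' (hz u hu).1)
    (D.minus.adj_mem_residue (by simp) hv' (hz v hv).1)
    (hz u hu).2.1 (hz u hu).2.2 (hz v hv).2.1 (hz v hv).2.2

theorem IsTwin.exists_op (hD : D.IsTwin) (c : Cp) : ∃ x, D.op c x := by
  obtain ⟨ω, -, -, hc⟩ := hD.tcs4.1 c
  obtain ⟨x, hx, -⟩ : c ∈ ω '' D.opSet c := by simp [hc]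
  exact ⟨x, hx⟩

/-- In a simply connected twin chamber system, locally exact labellings of the opposite pairs
are exact. -/
theorem IsTwin.exists_potential (hD : D.IsTwin) (hsc : D.SimplyConnected)
    (hl : D.LocallyExact l) :
    ∃ f : Cp → Cm → A, ∀ i c d x y, D.op c x → D.op d y → (D.plus.adj i).r c d →
      (D.minus.adj i).r x y → f d y = f c x * l i (c, x) (d, y) := by
  classical
  choose Φ hΦ using hD.exists_isFiberPotential hsc hl
  let μ : I → Cp → Cp → A := fun i c d =>
    if h : ∃ y, D.op c y ∧ D.op d y then transition l Φ i c d h.choose else 1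
  have hμ : ∀ i c d y, (D.plus.adj i).r c d → D.op c y → D.op d y →
      μ i c d = transition l Φ i c d y := by
    intro i c d y h hc hd
    have h' : ∃ y, D.op c y ∧ D.op d y := ⟨y, hc, hd⟩
    simp only [μ, dif_pos h']
    exact hD.transition_eq hl hΦ h h'.choose_spec.1 h'.choose_spec.2 hc hd
  -- On a residue, a local potential for `μ` is the constant by which `f` differs from `Φ d` on the
  -- fibre over `d`.
  obtain ⟨a, ha⟩ := hsc.1.exists_isPotentialOn (l := μ) (by
    intro J hJ c
    obtain ⟨x, hx⟩ := hD.exists_op c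
    obtain ⟨f, hf⟩ := hl J hJ c x
    have : Nonempty Cm := ⟨x⟩
    choose! z hz using fun d (hd : d ∈ D.plus.residue J c) => hD.exists_op_of_mem_residue hx hd
    refine ⟨fun d => f d (z d) * (Φ d (z d))⁻¹, fun j hj d hd d' hd' h => ?_⟩
    obtain ⟨y, hzy, hdy, hdy'⟩ := hD.tcs2.1 j d d' (z d) h (hz d hd).2
    have hy := D.minus.adj_mem_residue hj (hz d hd).1 hzy
    have e1 := hD.fiberPotential_eq hJ hf (hΦ d) hd (hz d hd).1 hy (hz d hd).2 hdy
    have e2 := hD.fiberPotential_eq hJ hf (hΦ d') hd' (hz d' hd').1 hy (hz d' hd').2 hdy'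
    simp only
    rw [e1, e2, hμ j d d' y h hdy hdy', hf j hj d hd d' hd' y hy y hy hdy hdy' h
      ((D.minus.adj j).refl y), transition]
    group)
  refine ⟨fun c x => a c * Φ c x, fun i c d x y hcx hdy hcd hxy => ?_⟩
  -- A step may change both coordinates, while `μ` is computed at a common opposite `z`; both are
  -- compared inside one pair of `{i}`-residues.
  obtain ⟨z, hxz, hcz, hdz⟩ := hD.tcs2.1 i c d x hcd hcx
  obtain ⟨f, hf⟩ := hl {i} (by simp) c x
  have hc := D.plus.mem_residue_self {i} c
  have hd := D.plus.adj_mem_residue (Set.mem_singleton i) hc hcd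
  have hx := D.minus.mem_residue_self {i} x
  have hy := D.minus.adj_mem_residue (Set.mem_singleton i) hx hxy
  have hz := D.minus.adj_mem_residue (Set.mem_singleton i) hx hxz
  have e1 := hD.fiberPotential_eq (by simp) hf (hΦ c) hc hx hz hcx hcz
  have e2 := hD.fiberPotential_eq (by simp) hf (hΦ d) hd hy hz hdy hdz
  have e3 := hf i rfl c hc d hd z hz z hz hcz hdz hcd ((D.minus.adj i).refl z)
  have e4 := hf i rfl c hc d hd x hx y hy hcx hdy hcd hxy
  have e5 : transition l Φ i c d z = (f c z * (Φ c z)⁻¹)⁻¹ * (f d z * (Φ d z)⁻¹) := by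
    rw [e3, transition]; group
  have e6 : l i (c, x) (d, y) = (f c x)⁻¹ * f d y := by rw [e4]; group
  simp only
  rw [ha i trivial c trivial d trivial hcd, hμ i c d z hcd hcz hdz, e5, ← e1, ← e2, e6]
  group

/-! ### Residue stabilisers in terms of the base pair. -/

variable {G : Type*} [Group G]

theorem mem_stab_iff {φ : G →* D.Aut} {c : Cp} {x : Cm} {J : Set I} {g : G} :
    g ∈ D.stab φ c x J ↔
      (φ g).1.1 c ∈ D.plus.residue J c ∧ (φ g).1.2 x ∈ D.minus.residue J x := by
  change (φ g).1.1 '' _ = _ ∧ (φ g).1.2 '' _ = _ ↔ _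
  rw [(φ g).2.1.image_residue, (φ g).2.2.1.image_residue]
  constructor
  · rintro ⟨h1, h2⟩
    exact ⟨h1 ▸ mem_residue_self _ _ _, h2 ▸ mem_residue_self _ _ _⟩
  · rintro ⟨h1, h2⟩
    exact ⟨residue_eq_of_mem _ h1, residue_eq_of_mem _ h2⟩

theorem inv_mul_mem_stab {φ : G →* D.Aut} {c : Cp} {x : Cm} {J : Set I} {g h : G}
    (h1 : (φ h).1.1 c ∈ D.plus.residue J ((φ g).1.1 c))
    (h2 : (φ h).1.2 x ∈ D.minus.residue J ((φ g).1.2 x)) : g⁻¹ * h ∈ D.stab φ c x J := by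
  rw [mem_stab_iff]
  have a := IsChamberMap.mem_residue (φ g).2.1.2 h1
  have b := IsChamberMap.mem_residue (φ g).2.2.1.2 h2
  simp only [Equiv.symm_apply_apply] at a b
  simpa using ⟨a, b⟩

end OppositionDatum

/-! ### The amalgamated product and an injectivity criterion. -/

section Amalgam

variable {G ι : Type*} [Group G] [Preorder ι] {H : ι → Subgroup G} {hH : Monotone H}

/-- The canonical homomorphism from one of the subgroups to the amalgamated product. -/
def Amalgam.of (H : ι → Subgroup G) (hH : Monotone H) (i : ι) : H i →* Amalgam H hH :=
  (QuotientGroup.mk' _).comp (Monoid.CoprodI.of (M := fun i => ↥(H i)) (i := i))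

theorem Amalgam.of_inclusion {i j : ι} (hij : i ≤ j) (x : H i) :
    Amalgam.of H hH j (Subgroup.inclusion (hH hij) x) = Amalgam.of H hH i x := by
  symm
  rw [← mul_inv_eq_one]
  simp only [Amalgam.of, MonoidHom.comp_apply, ← map_inv, ← map_mul]
  rw [QuotientGroup.mk'_apply, QuotientGroup.eq_one_iff]
  exact Subgroup.subset_normalClosure ⟨i, j, hij, x, by simp⟩

theorem Amalgam.toGroup_of (i : ι) (x : H i) :
    Amalgam.toGroup H hH (Amalgam.of H hH i x) = x := by
  simp [Amalgam.of, Amalgam.toGroup]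

theorem Amalgam.induction_on {p : Amalgam H hH → Prop} (a : Amalgam H hH) (one : p 1)
    (of_mul : ∀ a i (x : H i), p a → p (a * Amalgam.of H hH i x)) : p a := by
  obtain ⟨w, rfl⟩ := QuotientGroup.mk'_surjective _ a
  suffices h : ∀ b, p b → p (b * QuotientGroup.mk' _ w) by simpa using h 1 one
  induction w using Monoid.CoprodI.induction_on with
  | one => intro b hb; simpa using hb
  | of i x => exact fun b hb => of_mul b i x hb
  | mul u v hu hv =>
    intro b hb
    rw [map_mul, ← mul_assoc]
    exact hv _ (hu b hb)

open Classical in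
/-- The canonical map from a subgroup to the amalgamated product, extended by `1`. -/
noncomputable def Amalgam.ofExt (H : ι → Subgroup G) (hH : Monotone H) (i : ι) (g : G) :
    Amalgam H hH :=
  if h : g ∈ H i then Amalgam.of H hH i ⟨g, h⟩ else 1

theorem Amalgam.ofExt_eq {i : ι} {g : G} (h : g ∈ H i) :
    Amalgam.ofExt H hH i g = Amalgam.of H hH i ⟨g, h⟩ := dif_pos h

theorem Amalgam.ofExt_mul {i : ι} {g h : G} (hg : g ∈ H i) (hh : h ∈ H i) :
    Amalgam.ofExt H hH i (g * h) = Amalgam.ofExt H hH i g * Amalgam.ofExt H hH i h := by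
  rw [ofExt_eq hg, ofExt_eq hh, ofExt_eq (mul_mem hg hh), ← map_mul]
  rfl

theorem Amalgam.ofExt_of_le {i j : ι} (hij : i ≤ j) {g : G} (hg : g ∈ H i) :
    Amalgam.ofExt H hH i g = Amalgam.ofExt H hH j g := by
  rw [ofExt_eq hg, ofExt_eq (hH hij hg)]
  exact (Amalgam.of_inclusion hij ⟨g, hg⟩).symm

/-- Equivariance on the generating subgroups propagates to `ψ (toGroup a) = ψ 1 * a`, from which `a`
is recovered. -/
theorem Amalgam.toGroup_injective_of_section (ψ : G → Amalgam H hH)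
    (hψ : ∀ g i, ∀ h ∈ H i, ψ (g * h) = ψ g * Amalgam.ofExt H hH i h) :
    Function.Injective (Amalgam.toGroup H hH) := by
  have key : ∀ a, ψ (Amalgam.toGroup H hH a) = ψ 1 * a := by
    intro a
    induction a using Amalgam.induction_on with
    | one => simp
    | of_mul a i x ha =>
      rw [map_mul, Amalgam.toGroup_of, hψ _ i x x.2, ha, Amalgam.ofExt_eq x.2, mul_assoc]
  intro a b hab
  have := key a
  rw [hab, key b] at this
  exact (mul_left_cancel this).symm

end Amalgam

end TwinCS

/-! ### The amalgam theorem. -/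

open TwinCS OppositionDatum ChamberSystem in
theorem mainTheorem5 {I Cp Cm G : Type*} [Group G]
    (D : TwinCS.OppositionDatum I Cp Cm) (hD : D.IsTwin) (hsc : D.SimplyConnected)
    (φ : G →* D.Aut) (hφ : D.ActsTransitively φ)
    (c : Cp × Cm) (hc : c ∈ D.Opp) :
    TwinCS.IsAmalgamatedProduct
      (fun J : {J : Set I // J.encard ≤ 2} => D.stab φ c.1 c.2 J.1)
      (fun _ _ hJK => D.stab_mono φ c.1 c.2 hJK) := by
  set H : {J : Set I // J.encard ≤ 2} → Subgroup G := fun J => D.stab φ c.1 c.2 J.1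
  have hH : Monotone H := fun _ _ hJK => D.stab_mono φ c.1 c.2 hJK
  change Function.Bijective (Amalgam.toGroup H hH)
  choose! s hs using hφ c hc
  have hsmem : ∀ (J : Set I) (d e : Cp) (x y : Cm), D.op d x → D.op e y →
      e ∈ D.plus.residue J d → y ∈ D.minus.residue J x →
      (s (d, x))⁻¹ * s (e, y) ∈ D.stab φ c.1 c.2 J := by
    intro J d e x y hdx hey h1 h2
    apply inv_mul_mem_stab
    · rw [(hs (d, x) hdx).1, (hs (e, y) hey).1]; exact h1
    · rw [(hs (d, x) hdx).2, (hs (e, y) hey).2]; exact h2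
  have hop : ∀ g, D.op ((φ g).1.1 c.1) ((φ g).1.2 c.2) := fun g => ((φ g).2.2.2 _ _).2 hc
  have hsg : ∀ (J : Set I) g,
      (s ((φ g).1.1 c.1, (φ g).1.2 c.2))⁻¹ * g ∈ D.stab φ c.1 c.2 J := by
    intro J g
    apply inv_mul_mem_stab
    · rw [(hs _ (hop g)).1]; exact mem_residue_self _ _ _
    · rw [(hs _ (hop g)).2]; exact mem_residue_self _ _ _
  let E : {J : Set I // J.encard ≤ 2} := ⟨∅, by simp⟩
  let T : I → {J : Set I // J.encard ≤ 2} := fun i => ⟨{i}, by simp⟩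
  constructor
  · have hl : D.LocallyExact
        (fun i p q => Amalgam.ofExt H hH (T i) ((s p)⁻¹ * s q)) := by
      intro J hJ d x
      -- The two residues are arbitrary and may contain no opposite pair, in which case there is
      -- nothing to satisfy.
      by_cases h : ∃ d₀ ∈ D.plus.residue J d, ∃ x₀ ∈ D.minus.residue J x, D.op d₀ x₀
      · obtain ⟨d₀, hd₀, x₀, hx₀, h₀⟩ := h
        refine ⟨fun e y => Amalgam.ofExt H hH ⟨J, hJ⟩ ((s (d₀, x₀))⁻¹ * s (e, y)), ?_⟩
        intro j hj e he e' he' y hy y' hy' hey hey' hee' hyy'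
        rw [← residue_eq_of_mem _ hd₀] at he he'
        rw [← residue_eq_of_mem _ hx₀] at hy hy'
        have hstep := hsmem {j} e e' y y' hey hey'
          (adj_mem_residue _ (Set.mem_singleton j) (mem_residue_self _ _ _) hee')
          (adj_mem_residue _ (Set.mem_singleton j) (mem_residue_self _ _ _) hyy')
        have hle : T j ≤ ⟨J, hJ⟩ := Set.singleton_subset_iff.2 hj
        beta_reduce
        rw [Amalgam.ofExt_of_le (H := H) hle hstep, ← Amalgam.ofExt_mul (H := H) (i := ⟨J, hJ⟩)
          (hsmem J d₀ e x₀ y h₀ hey he hy) (hH hle hstep)]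
        congr 1
        group
      · refine ⟨fun _ _ => 1, fun j _ e he _ _ y hy _ _ hey => ?_⟩
        exact absurd ⟨e, he, y, hy, hey⟩ h
    obtain ⟨Φ, hΦ⟩ := hD.exists_potential hsc hl
    -- `Φ` controls single steps only; connectedness of the opposite pairs in residues of rank at
    -- most two extends the formula to all of `G_J`.
    have hΦJ : ∀ (J : {J : Set I // J.encard ≤ 2}) (d e : Cp) (x y : Cm), D.op d x → D.op e y →
        e ∈ D.plus.residue J.1 d → y ∈ D.minus.residue J.1 x →
        Φ e y = Φ d x * Amalgam.ofExt H hH J ((s (d, x))⁻¹ * s (e, y)) := by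
      intro J d e x y hdx hey he hy
      have h := hD.eq_of_step (J := J.1) (c := d) (x := x) (fun d => (hD.tcs3.1 d).2 J.1 x J.2)
        (fun e y => Φ e y * (Amalgam.ofExt H hH J ((s (d, x))⁻¹ * s (e, y)))⁻¹) ?_ hdx he hy hey
      · have h1 : Amalgam.ofExt H hH J 1 = 1 := by
          rw [Amalgam.ofExt_eq (one_mem _)]
          exact map_one (Amalgam.of H hH J)
        simp only [inv_mul_cancel, h1, inv_one, mul_one] at h
        rw [h, inv_mul_cancel_right]
      · intro j hj e he e' he' y hy y' hy' hey hey' hee' hyy'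
        have hstep := hsmem {j} e e' y y' hey hey'
          (adj_mem_residue _ (Set.mem_singleton j) (mem_residue_self _ _ _) hee')
          (adj_mem_residue _ (Set.mem_singleton j) (mem_residue_self _ _ _) hyy')
        have hle : T j ≤ J := Set.singleton_subset_iff.2 hj
        have hprod : (s (d, x))⁻¹ * s (e', y') =
            ((s (d, x))⁻¹ * s (e, y)) * ((s (e, y))⁻¹ * s (e', y')) := by group
        rw [hΦ j e e' y y' hey hey' hee' hyy', Amalgam.ofExt_of_le (H := H) hle hstep, hprod,
          Amalgam.ofExt_mul (H := H) (i := J) (hsmem J.1 d e x y hdx hey he hy) (hH hle hstep)]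
        group
    -- `Φ` sees `g` only through the image of the base pair; the second factor restores the part of
    -- `g` that fixes this pair.
    refine Amalgam.toGroup_injective_of_section (fun g =>
      Φ ((φ g).1.1 c.1) ((φ g).1.2 c.2) *
        Amalgam.ofExt H hH E ((s ((φ g).1.1 c.1, (φ g).1.2 c.2))⁻¹ * g)) ?_
    intro g J h hh
    have hh' := mem_stab_iff.1 hh
    have h1 : (φ (g * h)).1.1 c.1 ∈ D.plus.residue J.1 ((φ g).1.1 c.1) := by
      simpa using IsChamberMap.mem_residue (φ g).2.1.1 hh'.1
    have h2 : (φ (g * h)).1.2 c.2 ∈ D.minus.residue J.1 ((φ g).1.2 c.2) := by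
      simpa using IsChamberMap.mem_residue (φ g).2.2.1.1 hh'.2
    have hE : E ≤ J := Set.empty_subset J.1
    rw [hΦJ J _ _ _ _ (hop g) (hop (g * h)) h1 h2,
      Amalgam.ofExt_of_le (H := H) hE (hsg ∅ g), Amalgam.ofExt_of_le (H := H) hE (hsg ∅ (g * h)),
      mul_assoc, mul_assoc, ← Amalgam.ofExt_mul (H := H) (i := J)
        (hsmem J.1 _ _ _ _ (hop g) (hop (g * h)) h1 h2) (hsg J.1 (g * h)),
      ← Amalgam.ofExt_mul (H := H) (i := J) (hsg J.1 g) hh]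
    congr 2
    group
  · have hle : ∀ J, H J ≤ (Amalgam.toGroup H hH).range := fun J g hg =>
      ⟨Amalgam.of H hH J ⟨g, hg⟩, Amalgam.toGroup_of J _⟩
    have hR : ∀ x, D.minus.residue Set.univ x = Set.univ := fun x =>
      Set.eq_univ_of_forall fun y => hsc.2.1 x y
    -- Adjacent opposite pairs give the same coset of the range, so `s` has constant coset on the
    -- connected set of all opposite pairs.
    have hF := fun g => hD.eq_of_step (J := Set.univ) (c := c.1) (x := c.2)
      (fun d => by rw [hR, Set.inter_univ]; exact (hD.tcs3.1 d).1)
      (fun d y => (s (d, y) : G ⧸ (Amalgam.toGroup H hH).range))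
      (fun j _ e _ e' _ y _ y' _ hey hey' hee' hyy' => QuotientGroup.eq.2 <| hle (T j) <|
        hsmem {j} e e' y y' hey hey'
          (adj_mem_residue _ (Set.mem_singleton j) (mem_residue_self _ _ _) hee')
          (adj_mem_residue _ (Set.mem_singleton j) (mem_residue_self _ _ _) hyy'))
      hc (hsc.1.1 _ ((φ g).1.1 c.1)) (hsc.2.1 _ ((φ g).1.2 c.2)) (hop g)
    intro g
    -- With base pair `c`, `g = s c * ((s c)⁻¹ * s (g c)) * ((s (g c))⁻¹ * g)`; the outer factors
    -- fix `c`, the middle one is `h3`.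
    have h1 := hle E (hsg ∅ 1)
    have h2 := hle E (hsg ∅ g)
    have h3 := QuotientGroup.eq.1 (hF g)
    simp only [map_one, OneMemClass.coe_one, Prod.fst_one, Prod.snd_one, Equiv.Perm.coe_one,
      id_eq, mul_one] at h1
    have h4 := mul_mem (mul_mem (inv_mem h1) h3) h2
    rw [← MonoidHom.mem_range]
    convert h4 using 1
    simp only [inv_inv]
    group
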